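/- A group topology $\tau$ on an Abelian group $G$ is called \emph{totally bounded} if it is Hausdorff and precompact, i.e. for every nonempty $\tau$-open $U\subseteq G$ there is a finite $F\subseteq G$ with $G=F+U$. An \emph{SC-group topology} on $G$ is a totally bounded group topology on $G$ in which every subgroup of $G$ is closed. $G$ is \emph{of bounded order} if $nG=0$ for some integer $n\ge 1$, and $r_0(G)$ denotes the torsion-free rank of $G$. \textbf{Theorem.} Let $\alpha$ and $\beta$ be infinite cardinals with $2^\beta\le\alpha$. (a) There is an Abelian torsion group $G$ with $|G|=\alpha$ such that the number of SC-group topologies on $G$ is exactly $2^{2^\beta}$, and $2^{2^\beta}<2^{2^{|G|}}$. (b) There is an Abelian group $G$ with $|G|=\alpha$ and $r_0(G)=\beta<\alpha$ such that the number of SC-group topologies on $G$ is exactly $2^{2^\beta}$, and $2^{2^\beta}<2^{2^{|G|}}$. Consequently, the following question has a negative answer in both cases: does every infinite Abelian group $G$ which is not of bounded order admit exactly $2^{2^{|G|}}$ SC-group topologies if (i) $G$ is a torsion group, or (ii) $0<r_0(G)<|G|$? That is, in each of the cases (i) and (ii) there is an infinite Abelian group, not of bounded order, for which the number of SC-group topologies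 is not $2^{2^{|G|}}$. -/

import Mathlib

open Cardinal
open scoped Pointwise Topology

universe u

/-- A topology on a group `G` is precompact if finitely many translates of any nonempty open set
cover `G`. -/
def IsPrecompactTopology {G : Type u} [AddCommGroup G] (τ : TopologicalSpace G) : Prop :=
  ∀ U : Set G, IsOpen[τ] U → U.Nonempty → ∃ F : Set G, F.Finite ∧ F + U = Set.univ

/-- A totally bounded group topology: a precompact Hausdorff group topology. -/
structure IsTotallyBoundedGroupTopology {G : Type u} [AddCommGroup G]
    (τ : TopologicalSpace G) : Prop where
  isTopologicalAddGroup : @IsTopologicalAddGroup G τ _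
  t2Space : @T2Space G τ
  isPrecompact : IsPrecompactTopology τ

/-- An SC-group topology: a totally bounded group topology in which every subgroup is closed. -/
structure IsSCGroupTopology {G : Type u} [AddCommGroup G] (τ : TopologicalSpace G) : Prop where
  isTotallyBounded : IsTotallyBoundedGroupTopology τ
  isClosed_subgroup : ∀ H : AddSubgroup G, IsClosed[τ] (H : Set G)

/-- The number of SC-group topologies on `G`. -/
noncomputable def numSCGroupTopologies (G : Type u) [AddCommGroup G] : Cardinal.{u} :=
  #{τ : TopologicalSpace G // IsSCGroupTopology τ}

/-- `G` is of bounded order if `n G = 0` for some positive integer `n`. -/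
def IsOfBoundedOrder (G : Type u) [AddCommGroup G] : Prop :=
  ∃ n : ℕ, 0 < n ∧ ∀ g : G, n • g = 0

/-- The torsion-free rank: the largest cardinality of a family that is linearly independent
over `ℤ`. -/
noncomputable def torsionFreeRank (G : Type u) [AddCommGroup G] : Cardinal.{u} :=
  Module.rank ℤ G

/-! Both groups have the form `V × K` with `V` an elementary 2-group of size `α` and `K` of size
`β`. The large factor `V` adds no freedom, while `K` already carries `2 ^ 2 ^ β` topologies.

Upper bound: in a precompact group topology every neighbourhood of zero contains a finite-index
subgroup of `V`. This is Bogolyubov's lemma on finite subgroups, carried to `V` by an ultrafilter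
(`exists_finiteIndex_subset_of_syndetic`). In an SC-topology, conversely, every finite-index
subgroup of `V × K` is closed, hence open. So the topology can be recovered from its trace on `K`, a
filter on a set of size `β` (`IsSCGroupTopology.mem_nhds_zero_iff`).

Lower bound: if the characters in `N` separate subgroups, so do those in any larger set, and each
such set induces an SC-topology. It suffices to find `2 ^ β` characters independent over `N`, since
distinct subsets of them then give distinct topologies (`IndependentOver.le_numSCGroupTopologies`).
They come from an independent family of subsets of a set of size `β`. For the torsion group, `K` is
a sum of copies of `⨁ ZMod p` and `N` consists of the characters of finite order. For the group of
rank `β`, `K` is free and `N` consists of the characters with torsion values. -/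

/-! ### Fourier analysis on finite abelian groups: Bogolyubov's lemma. -/

section Bogolyubov

variable {E : Type*} [AddCommGroup E]

/-- The squared modulus of the Fourier coefficient of the indicator function of `A`. -/
noncomputable def fourierEnergy (A : Finset E) (χ : AddChar E ℂ) : ℝ :=
  Complex.normSq (∑ a ∈ A, χ a)

theorem fourierEnergy_nonneg (A : Finset E) (χ : AddChar E ℂ) : 0 ≤ fourierEnergy A χ :=
  Complex.normSq_nonneg _

theorem fourierEnergy_zero (A : Finset E) : fourierEnergy A 0 = (A.card : ℝ) ^ 2 := by
  simp [fourierEnergy, sq]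

variable [Fintype E]

theorem ofReal_fourierEnergy (A : Finset E) (χ : AddChar E ℂ) :
    (fourierEnergy A χ : ℂ) = ∑ a ∈ A, ∑ b ∈ A, χ (a - b) := by
  rw [fourierEnergy, ← Complex.mul_conj, map_sum, Finset.sum_mul_sum]
  simp only [← AddChar.map_neg_eq_conj, ← AddChar.map_add_eq_mul, sub_eq_add_neg]

/-- Parseval: by orthogonality only the diagonal terms `a = b` survive. -/
theorem sum_fourierEnergy (A : Finset E) :
    ∑ χ : AddChar E ℂ, fourierEnergy A χ = Fintype.card E * A.card := by
  classical
  have h : ((∑ χ : AddChar E ℂ, fourierEnergy A χ : ℝ) : ℂ) = Fintype.card E * A.card := by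
    push_cast
    simp only [ofReal_fourierEnergy]
    rw [Finset.sum_comm]
    simp_rw [Finset.sum_comm (s := Finset.univ) (t := A), AddChar.sum_apply_eq_ite, sub_eq_zero]
    simp [mul_comm]
  exact_mod_cast h

/-- By Fourier inversion the sum is `Fintype.card E` times the number of representations `x = (a -
b) + (c - d)` in `A`. -/
theorem sum_fourierEnergy_sq_mul_eq_zero (A : Finset E) (x : E)
    (hx : ∀ a ∈ A, ∀ b ∈ A, ∀ c ∈ A, ∀ d ∈ A, x ≠ (a - b) + (c - d)) :
    ∑ χ : AddChar E ℂ, (fourierEnergy A χ : ℂ) ^ 2 * χ (-x) = 0 := by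
  classical
  have key : ∀ χ : AddChar E ℂ, (fourierEnergy A χ : ℂ) ^ 2 * χ (-x) =
      ∑ a ∈ A, ∑ b ∈ A, ∑ c ∈ A, ∑ d ∈ A, χ ((a - b) + (c - d) + -x) := by
    intro χ
    rw [ofReal_fourierEnergy, sq]
    simp only [AddChar.map_add_eq_mul, ← Finset.sum_mul, ← Finset.mul_sum]
  simp_rw [key, Finset.sum_comm (s := Finset.univ) (t := A), AddChar.sum_apply_eq_ite]
  refine Finset.sum_eq_zero fun a ha => Finset.sum_eq_zero fun b hb => Finset.sum_eq_zero
    fun c hc => Finset.sum_eq_zero fun d hd => if_neg fun h => hx a ha b hb c hc d hd ?_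
  rw [← sub_eq_add_neg, sub_eq_zero] at h
  exact h.symm

/-- Bogolyubov's lemma: if `A` has density at least `1 / k` in a finite abelian group, then
`(A - A) + (A - A)` contains the common kernel of at most `k ^ 2` characters. -/
theorem exists_addChar_common_kernel_subset (A : Finset E) (hA : A.Nonempty) (k : ℕ)
    (hk : Fintype.card E ≤ k * A.card) :
    ∃ R : Finset (AddChar E ℂ), R.card ≤ k ^ 2 ∧ ∀ x, (∀ χ ∈ R, χ x = 1) →
      ∃ a ∈ A, ∃ b ∈ A, ∃ c ∈ A, ∃ d ∈ A, x = (a - b) + (c - d) := by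
  classical
  set n : ℝ := (Fintype.card E : ℝ) with hn
  set m : ℝ := (A.card : ℝ) with hm
  have hm0 : 0 < m := by simpa [hm] using hA
  have hmn : m ≤ n := by simpa [hm, hn] using Finset.card_le_univ A
  have hn0 : 0 < n := hm0.trans_le hmn
  have hkm : n ≤ k * m := by rw [hn, hm]; exact_mod_cast hk
  -- The threshold serves both bounds. By Parseval at most `n * m / c = (n / m) ^ 2 ≤ k ^ 2`
  -- characters have energy at least `c`. The others contribute at most `c * (n * m) = m ^ 4` in
  -- absolute value to the inversion sum, which is just the contribution of the trivial character.
  set c : ℝ := m ^ 3 / n with hc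
  have hc0 : 0 < c := by positivity
  have hcn : c * n = m ^ 3 := by rw [hc]; field_simp
  set R : Finset (AddChar E ℂ) := Finset.univ.filter fun χ => c ≤ fourierEnergy A χ with hR
  have hsplit := Finset.sum_filter_add_sum_filter_not (Finset.univ : Finset (AddChar E ℂ))
    (fun χ => c ≤ fourierEnergy A χ) (fourierEnergy A)
  rw [sum_fourierEnergy, ← hR, ← hn, ← hm] at hsplit
  have h0R : (0 : AddChar E ℂ) ∈ R := by
    rw [hR, Finset.mem_filter, fourierEnergy_zero]
    refine ⟨Finset.mem_univ _, ?_⟩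
    rw [hc, div_le_iff₀ hn0, ← hm]
    nlinarith [sq_nonneg m]
  have hrest0 : 0 ≤ ∑ χ with ¬ c ≤ fourierEnergy A χ, fourierEnergy A χ :=
    Finset.sum_nonneg fun χ _ => fourierEnergy_nonneg A χ
  refine ⟨R, ?_, fun x hx => ?_⟩
  · have h1 : R.card * c ≤ n * m := by
      have : ∑ χ ∈ R, c ≤ ∑ χ ∈ R, fourierEnergy A χ :=
        Finset.sum_le_sum fun χ hχ => (Finset.mem_filter.1 hχ).2
      rw [Finset.sum_const, nsmul_eq_mul] at this
      linarith
    have h2 : (R.card : ℝ) * m ^ 2 ≤ n ^ 2 := by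
      have : (R.card : ℝ) * m ^ 3 ≤ n ^ 2 * m := by
        rw [← hcn]; nlinarith
      have h3 : ((R.card : ℝ) * m ^ 2) * m ≤ n ^ 2 * m := by nlinarith
      exact le_of_mul_le_mul_right h3 hm0
    have h3 : (R.card : ℝ) * m ^ 2 ≤ k ^ 2 * m ^ 2 := by
      rw [← mul_pow]
      exact h2.trans (pow_le_pow_left₀ hn0.le hkm 2)
    have h4 : (R.card : ℝ) ≤ k ^ 2 := le_of_mul_le_mul_right h3 (by positivity)
    exact_mod_cast h4
  · by_contra hcon
    have hzero := sum_fourierEnergy_sq_mul_eq_zero A x fun a ha b hb c hc d hd h =>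
      hcon ⟨a, ha, b, hb, c, hc, d, hd, h⟩
    have hre : ∑ χ : AddChar E ℂ, fourierEnergy A χ ^ 2 * (χ (-x)).re = 0 := by
      have := congrArg Complex.re hzero
      simpa [← Complex.ofReal_pow, Complex.re_ofReal_mul] using this
    rw [← Finset.sum_filter_add_sum_filter_not _ (fun χ => c ≤ fourierEnergy A χ), ← hR] at hre
    have hin : m ^ 4 ≤ ∑ χ ∈ R, fourierEnergy A χ ^ 2 * (χ (-x)).re := by
      have heq : ∀ χ ∈ R, fourierEnergy A χ ^ 2 * (χ (-x)).re = fourierEnergy A χ ^ 2 := by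
        intro χ hχ
        rw [AddChar.map_neg_eq_inv, hx χ hχ]; simp
      rw [Finset.sum_congr rfl heq]
      refine le_trans (le_of_eq ?_) (Finset.single_le_sum (fun χ _ => sq_nonneg _) h0R)
      rw [fourierEnergy_zero]; ring
    -- Removing the trivial character's energy from the Parseval total makes the final comparison
    -- strict.
    have hle : ∑ χ ∈ R, fourierEnergy A χ ≥ m ^ 2 := by
      refine le_trans (le_of_eq ?_)
        (Finset.single_le_sum (fun χ _ => fourierEnergy_nonneg A χ) h0R)
      rw [fourierEnergy_zero]
    have hout : -(c * ∑ χ with ¬ c ≤ fourierEnergy A χ, fourierEnergy A χ) ≤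
        ∑ χ with ¬ c ≤ fourierEnergy A χ, fourierEnergy A χ ^ 2 * (χ (-x)).re := by
      rw [Finset.mul_sum, ← Finset.sum_neg_distrib]
      refine Finset.sum_le_sum fun χ hχ => ?_
      have h1 : fourierEnergy A χ ≤ c := (not_le.1 (Finset.mem_filter.1 hχ).2).le
      have h2 := fourierEnergy_nonneg A χ
      have h3 : -1 ≤ (χ (-x)).re := by
        have := Complex.abs_re_le_norm (χ (-x))
        rw [AddChar.norm_apply] at this
        exact (abs_le.1 this).1
      nlinarith [mul_nonneg h2 (sub_nonneg.2 h1), mul_nonneg (sq_nonneg (fourierEnergy A χ))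
        (by linarith : 0 ≤ (χ (-x)).re + 1)]
    have h5 : c * ∑ χ with ¬ c ≤ fourierEnergy A χ, fourierEnergy A χ ≤ c * (n * m - m ^ 2) :=
      mul_le_mul_of_nonneg_left (by linarith) hc0.le
    have h6 : c * (n * m - m ^ 2) = m ^ 4 - c * m ^ 2 := by
      linear_combination m * hcn
    have h7 : 0 < c * m ^ 2 := by positivity
    linarith

end Bogolyubov

/-! ### From finite groups to arbitrary groups of exponent two. -/

/-- In a group of exponent two, if finitely many translates of `U` cover the group, then
`(U - U) + (U - U)` contains a subgroup of finite index. -/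
theorem exists_finiteIndex_subset_of_syndetic {V : Type*} [AddCommGroup V]
    (hV : ∀ v : V, v + v = 0) (U F : Set V) (hF : F.Finite) (hU : F + U = Set.univ) :
    ∃ H : AddSubgroup V, H.FiniteIndex ∧ ∀ v ∈ H,
      ∃ a ∈ U - U, ∃ b ∈ U - U, v = a + b := by
  classical
  obtain ⟨F, rfl⟩ := hF.exists_finset_coe
  set k := F.card with hk
  have hfin : ∀ s : Finset V, Finite (AddSubgroup.closure (s : Set V)) := by
    intro s
    have : AddGroup.FG (AddSubgroup.closure (s : Set V)) :=
      AddGroup.closure_finset_fg s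
    refine AddCommGroup.finite_of_fg_isAddTorsion _ ?_
    intro x
    rw [isOfFinAddOrder_iff_nsmul_eq_zero]
    exact ⟨2, two_pos, by rw [two_nsmul]; exact Subtype.ext (hV _)⟩
  have hloc : ∀ s : Finset V, ∃ χ : Fin (k ^ 2) → AddChar (AddSubgroup.closure (s : Set V)) ℂ,
      ∀ x, (∀ i, χ i x = 1) → ∃ a ∈ U - U, ∃ b ∈ U - U, (x : V) = a + b := by
    intro s
    set E := AddSubgroup.closure (s : Set V)
    have := hfin s
    let _ : Fintype E := Fintype.ofFinite E
    let A : V → Finset E := fun f => Finset.univ.filter fun e => (e : V) - f ∈ U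
    -- Pigeonhole: the `k` traces on `E` of the translates of `U` cover `E`, though the translating
    -- elements need not lie in `E`.
    obtain ⟨f, hf, hcard⟩ : ∃ f ∈ F, Fintype.card E ≤ k * (A f).card := by
      by_contra! hcon
      have hcov : (Finset.univ : Finset E) ⊆ F.biUnion A := by
        intro e _
        obtain ⟨f, hf, w, hw, h⟩ : (e : V) ∈ (F : Set V) + U := hU ▸ Set.mem_univ _
        refine Finset.mem_biUnion.2 ⟨f, hf, Finset.mem_filter.2 ⟨Finset.mem_univ _, ?_⟩⟩
        rwa [← h, add_sub_cancel_left]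
      have h1 := (Finset.card_le_card hcov).trans Finset.card_biUnion_le
      rw [Finset.card_univ] at h1
      have hFne : F.Nonempty := by
        rw [Finset.nonempty_iff_ne_empty]
        rintro rfl
        simp [Fintype.card_ne_zero] at h1
      have h2 : ∑ f ∈ F, k * (A f).card < ∑ f ∈ F, Fintype.card E :=
        Finset.sum_lt_sum_of_nonempty hFne hcon
      rw [← Finset.mul_sum, Finset.sum_const, smul_eq_mul, ← hk] at h2
      exact absurd (Nat.mul_le_mul_left k h1) (not_le.2 h2)
    have hAne : (A f).Nonempty := by
      rw [← Finset.card_pos]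
      rcases Nat.eq_zero_or_pos (A f).card with h | h
      · rw [h, mul_zero] at hcard
        exact absurd (Nat.le_zero.1 hcard) Fintype.card_ne_zero
      · exact h
    obtain ⟨R, hRcard, hR⟩ := exists_addChar_common_kernel_subset (A f) hAne k hcard
    obtain ⟨g⟩ : Nonempty (R ↪ Fin (k ^ 2)) :=
      Function.Embedding.nonempty_of_card_le (by simpa using hRcard)
    -- Padding with the trivial character, which imposes no condition, gives an index set
    -- independent of `s`, as the limit below needs.
    refine ⟨fun i => if h : ∃ χ : R, g χ = i then (h.choose : AddChar E ℂ) else 1, fun x hx => ?_⟩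
    obtain ⟨a, ha, b, hb, c, hc, d, hd, h⟩ := hR x fun χ hχ => by
      have hex : ∃ χ' : R, g χ' = g ⟨χ, hχ⟩ := ⟨_, rfl⟩
      have h := hx (g ⟨χ, hχ⟩)
      beta_reduce at h
      rwa [dif_pos hex, g.injective hex.choose_spec] at h
    refine ⟨(a : V) - b, ?_, (c : V) - d, ?_, by rw [h]; simp⟩
    · rw [← sub_sub_sub_cancel_right _ _ f]
      exact Set.sub_mem_sub (Finset.mem_filter.1 ha).2 (Finset.mem_filter.1 hb).2
    · rw [← sub_sub_sub_cancel_right _ _ f]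
      exact Set.sub_mem_sub (Finset.mem_filter.1 hc).2 (Finset.mem_filter.1 hd).2
  choose χ hχ using hloc
  -- `V` is the directed union of its finitely generated subgroups. Characters there take only the
  -- values `1` and `-1`, so each `χ s i` has a limit along the ultrafilter; `H i` is the kernel of
  -- that limit, of index at most two.
  let 𝒰 : Ultrafilter (Finset V) := Ultrafilter.of Filter.atTop
  let P : Fin (k ^ 2) → V → Finset V → Prop := fun i v s =>
    ∃ h : v ∈ AddSubgroup.closure (s : Set V), χ s i ⟨v, h⟩ = 1
  have hmem : ∀ v : V, ∀ᶠ s : Finset V in 𝒰, v ∈ AddSubgroup.closure (s : Set V) := by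
    intro v
    have : ∀ᶠ s : Finset V in Filter.atTop, v ∈ AddSubgroup.closure (s : Set V) := by
      filter_upwards [Filter.eventually_ge_atTop {v}] with s hs
      exact AddSubgroup.subset_closure (hs (Finset.mem_singleton_self v))
    exact Ultrafilter.of_le Filter.atTop this
  let H : Fin (k ^ 2) → AddSubgroup V := fun i =>
    { carrier := {v | ∀ᶠ s in 𝒰, P i v s}
      zero_mem' := Filter.Eventually.of_forall fun s => ⟨zero_mem _, AddChar.map_zero_eq_one _⟩
      add_mem' := by
        intro v w hv hw
        filter_upwards [hv, hw] with s hv hw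
        obtain ⟨hv, hv1⟩ := hv
        obtain ⟨hw, hw1⟩ := hw
        refine ⟨add_mem hv hw, ?_⟩
        have := AddChar.map_add_eq_mul (χ s i) ⟨v, hv⟩ ⟨w, hw⟩
        rwa [hv1, hw1, one_mul] at this
      neg_mem' := by
        intro v hv
        rwa [neg_eq_of_add_eq_zero_left (hV v)] }
  have hadd : ∀ i v w, v ∉ H i → w ∉ H i → v + w ∈ H i := by
    intro i v w hv hw
    have hv : ∀ᶠ s in 𝒰, ¬ P i v s := Ultrafilter.eventually_not.2 hv
    have hw : ∀ᶠ s in 𝒰, ¬ P i w s := Ultrafilter.eventually_not.2 hw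
    change ∀ᶠ s in 𝒰, P i (v + w) s
    filter_upwards [hv, hw, hmem v, hmem w] with s hv hw hvs hws
    have hneg : ∀ (v : V) (h : v ∈ AddSubgroup.closure (s : Set V)),
        ¬ P i v s → χ s i ⟨v, h⟩ = -1 := by
      intro v h hv
      have h1 := AddChar.map_add_eq_mul (χ s i) ⟨v, h⟩ ⟨v, h⟩
      have h2 : (⟨v, h⟩ + ⟨v, h⟩ : AddSubgroup.closure (s : Set V)) = 0 := Subtype.ext (hV v)
      rw [h2, AddChar.map_zero_eq_one] at h1
      exact (mul_self_eq_one_iff.1 h1.symm).resolve_left fun h3 => hv ⟨h, h3⟩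
    refine ⟨add_mem hvs hws, ?_⟩
    have := AddChar.map_add_eq_mul (χ s i) ⟨v, hvs⟩ ⟨w, hws⟩
    rw [hneg v hvs hv, hneg w hws hw] at this
    rw [← mul_one (1 : ℂ), ← neg_mul_neg]
    exact this
  refine ⟨⨅ i, H i, AddSubgroup.finiteIndex_iInf fun i => ?_, fun v hv => ?_⟩
  · by_cases htop : H i = ⊤
    · rw [htop]; infer_instance
    · obtain ⟨a, ha⟩ : ∃ a, a ∉ H i := by
        by_contra! h
        exact htop ((AddSubgroup.eq_top_iff' _).2 h)
      refine ⟨?_⟩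
      rw [AddSubgroup.index_eq_two_iff.2 ⟨a, fun b => ?_⟩]
      · exact two_ne_zero
      · by_cases hb : b ∈ H i
        · exact Or.inr ⟨hb, fun h => ha ((add_mem_cancel_left hb).1 h)⟩
        · exact Or.inl ⟨hadd i b a hb ha, hb⟩
  · rw [AddSubgroup.mem_iInf] at hv
    -- The number of characters being finite and fixed, a single `s` witnesses all the conditions.
    have hall : ∀ᶠ s in 𝒰, ∀ i, P i v s := Filter.eventually_all.2 hv
    obtain ⟨s, hs, hvs⟩ := (hall.and (hmem v)).exists
    exact hχ s ⟨v, hvs⟩ fun i => (hs i).2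

/-! ### Upper bound: a summand of exponent two adds no topologies. -/

section ExponentTwoSummand

variable {V K : Type u} [AddCommGroup V] [AddCommGroup K]

/-- In a precompact group topology on `V × K` with `V` of exponent two, every neighbourhood of
zero contains a subgroup of finite index of `V`. -/
theorem IsPrecompactTopology.exists_finiteIndex_inl_mem (hV : ∀ v : V, v + v = 0)
    [τ : TopologicalSpace (V × K)] [IsTopologicalAddGroup (V × K)]
    (hτ : IsPrecompactTopology τ) {U : Set (V × K)} (hU : U ∈ 𝓝 0) :
    ∃ H : AddSubgroup V, H.FiniteIndex ∧ ∀ v ∈ H, (v, (0 : K)) ∈ U := by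
  obtain ⟨U₁, hU₁, h₁⟩ := exists_nhds_zero_half hU
  obtain ⟨U₂, hU₂, h₂⟩ := exists_nhds_half_neg hU₁
  obtain ⟨U₃, hU₃, h₃⟩ := exists_nhds_half_neg hU₂
  obtain ⟨O, hO, hOopen, h0⟩ := mem_nhds_iff.1 hU₃
  obtain ⟨F, hF, hFO⟩ := hτ O hOopen ⟨0, h0⟩
  classical
  -- The covering elements need not lie in `V`. Each `f` whose translate of `O` meets `V` is
  -- replaced by a point of that intersection, at the price of enlarging `O` to `O - O`; the default
  -- value is never used.
  let r : V × K → V := fun f => if h : ∃ v : V, (v, (0 : K)) - f ∈ O then h.choose else 0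
  have hcov : r '' F + {v : V | (v, (0 : K)) ∈ U₂} = Set.univ := by
    refine Set.eq_univ_of_forall fun v => ?_
    obtain ⟨f, hf, o, ho, h⟩ : (v, (0 : K)) ∈ F + O := hFO ▸ Set.mem_univ _
    have hv : (v, (0 : K)) - f ∈ O := by rwa [← h, add_sub_cancel_left]
    have hex : ∃ v : V, (v, (0 : K)) - f ∈ O := ⟨v, hv⟩
    have hr : (r f, (0 : K)) - f ∈ O := by
      simp only [r, dif_pos hex]
      exact hex.choose_spec
    refine ⟨r f, ⟨f, hf, rfl⟩, v - r f, ?_, add_sub_cancel _ _⟩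
    have := h₃ _ (hO hv) _ (hO hr)
    rw [sub_sub_sub_cancel_right, Prod.mk_sub_mk, sub_zero] at this
    exact this
  obtain ⟨H, hH, hsub⟩ := exists_finiteIndex_subset_of_syndetic hV _ _ (hF.image r) hcov
  refine ⟨H, hH, fun v hv => ?_⟩
  obtain ⟨_, ⟨a, ha, b, hb, rfl⟩, _, ⟨c, hc, d, hd, rfl⟩, rfl⟩ := hsub v hv
  have := h₁ _ (h₂ _ ha _ hb) _ (h₂ _ hc _ hd)
  simpa using this

/-- An SC-group topology on `V × K`, with `V` of exponent two, is determined by its trace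
on `K`. -/
theorem IsSCGroupTopology.mem_nhds_zero_iff (hV : ∀ v : V, v + v = 0)
    {τ : TopologicalSpace (V × K)} (hτ : IsSCGroupTopology τ) (U : Set (V × K)) :
    U ∈ @nhds _ τ 0 ↔ ∃ H : AddSubgroup V, H.FiniteIndex ∧
      ∃ O ∈ Filter.comap (fun k : K => ((0 : V), k)) (@nhds _ τ 0),
        ∀ v ∈ H, ∀ k ∈ O, (v, k) ∈ U := by
  have := hτ.isTotallyBounded.isTopologicalAddGroup
  have hpre := hτ.isTotallyBounded.isPrecompact
  constructor
  · intro hU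
    obtain ⟨W, hW, hWU⟩ := exists_nhds_zero_half hU
    obtain ⟨H, hH, hHW⟩ := hpre.exists_finiteIndex_inl_mem hV hW
    refine ⟨H, hH, _, Filter.preimage_mem_comap hW, fun v hv k hk => ?_⟩
    simpa using hWU _ (hHW v hv) _ hk
  · rintro ⟨H, hH, O, ⟨W, hW, hWO⟩, hU⟩
    obtain ⟨W₁, hW₁, hsub⟩ := exists_nhds_half_neg hW
    obtain ⟨H₁, hH₁, hHW⟩ := hpre.exists_finiteIndex_inl_mem hV hW₁
    -- `L` has finite index and is closed, hence open. For `(v, k)` in `L ∩ W₁`, subtracting `(v, 0)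
    -- ∈ W₁` puts `(0, k)` in `W`, so `k ∈ O`.
    let L : AddSubgroup (V × K) := (H ⊓ H₁).comap (AddMonoidHom.fst V K)
    have : L.FiniteIndex := ⟨by
      rw [AddSubgroup.index_comap_of_surjective _ fun v => ⟨(v, 0), rfl⟩]
      exact AddSubgroup.FiniteIndex.index_ne_zero⟩
    have hL : IsOpen (L : Set (V × K)) :=
      AddSubgroup.isOpen_of_isClosed_of_finiteIndex L (hτ.isClosed_subgroup L)
    filter_upwards [hW₁, hL.mem_nhds L.zero_mem] with g hg hgL
    refine hU g.1 hgL.1 g.2 (hWO ?_)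
    have := hsub _ hg _ (hHW g.1 hgL.2)
    have h : g - (g.1, (0 : K)) = (0, g.2) := by ext <;> simp
    rwa [h] at this

theorem numSCGroupTopologies_le_of_exponent_two (hV : ∀ v : V, v + v = 0) :
    numSCGroupTopologies (V × K) ≤ 2 ^ ((2 : Cardinal.{u}) ^ #K) := by
  let Φ : {τ : TopologicalSpace (V × K) // IsSCGroupTopology τ} → Set (Set K) := fun τ =>
    (Filter.comap (fun k : K => ((0 : V), k)) (@nhds _ τ.1 0)).sets
  have hΦ : Function.Injective Φ := by
    intro τ σ h
    have hf := Filter.filter_eq h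
    refine Subtype.ext (IsTopologicalAddGroup.ext
      τ.2.isTotallyBounded.isTopologicalAddGroup
      σ.2.isTotallyBounded.isTopologicalAddGroup ?_)
    ext U
    rw [τ.2.mem_nhds_zero_iff hV, σ.2.mem_nhds_zero_iff hV, hf]
  simpa [numSCGroupTopologies, mk_set] using mk_le_of_injective hΦ

end ExponentTwoSummand

/-! ### Topologies induced by characters, and the lower bound. -/

section CharacterTopology

variable {G : Type u} [AddCommGroup G]

/-- The circle has no small subgroups: below `1 / 4`, doubling an element doubles its distance to
zero. -/
theorem UnitAddCircle.exists_quarter_le_norm_nsmul {t : UnitAddCircle} (ht : t ≠ 0) :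
    ∃ n : ℕ, 1 / 4 ≤ ‖n • t‖ := by
  by_contra! h
  have hdouble : ∀ s : UnitAddCircle, ‖s‖ < 1 / 4 → ‖2 • s‖ = 2 * ‖s‖ := by
    intro s hs
    obtain ⟨x, rfl⟩ := QuotientAddGroup.mk_surjective s
    have hx := UnitAddCircle.norm_eq (x := x)
    change ‖(x : UnitAddCircle)‖ < 1 / 4 at hs
    change ‖2 • (x : UnitAddCircle)‖ = 2 * ‖(x : UnitAddCircle)‖
    have hy : (x : UnitAddCircle) = ((x - round x : ℝ) : UnitAddCircle) := by
      rw [eq_comm, ← sub_eq_zero, ← AddCircle.coe_sub, AddCircle.coe_eq_zero_iff]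
      exact ⟨-round x, by simp⟩
    rw [hx] at hs ⊢
    rw [hy, ← AddCircle.coe_nsmul, (AddCircle.norm_coe_eq_abs_iff (1 : ℝ) one_ne_zero).2]
    · rw [nsmul_eq_mul, abs_mul]; norm_num
    · rw [nsmul_eq_mul, abs_mul]; norm_num; linarith
  have hpow : ∀ k : ℕ, ‖(2 ^ k) • t‖ = 2 ^ k * ‖t‖ := by
    intro k
    induction k with
    | zero => simp
    | succ k ih =>
      rw [pow_succ', mul_nsmul', hdouble _ (h _), ih]
      ring
  have hpos := norm_pos_iff.2 ht
  obtain ⟨k, hk⟩ := pow_unbounded_of_one_lt (1 / ‖t‖) (one_lt_two (α := ℝ))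
  have h1 := h (2 ^ k)
  rw [hpow] at h1
  rw [div_lt_iff₀ hpos] at hk
  linarith

/-- The group topology induced by a set of characters. -/
abbrev charTopology (N : Set (G →+ UnitAddCircle)) : TopologicalSpace G :=
  ⨅ χ : N, TopologicalSpace.induced χ.1 inferInstance

theorem isTopologicalAddGroup_charTopology (N : Set (G →+ UnitAddCircle)) :
    @IsTopologicalAddGroup G (charTopology N) _ :=
  topologicalAddGroup_iInf fun χ => topologicalAddGroup_induced χ.1

theorem continuous_charTopology {N : Set (G →+ UnitAddCircle)} {χ : G →+ UnitAddCircle}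
    (hχ : χ ∈ N) : @Continuous _ _ (charTopology N) _ χ :=
  continuous_iInf_dom (i := (⟨χ, hχ⟩ : N)) continuous_induced_dom

/-- The topology is induced from a compact power of the circle. A finite cover there is pulled back
by moving its centres into the image of `G`. -/
theorem isPrecompactTopology_charTopology (N : Set (G →+ UnitAddCircle)) :
    IsPrecompactTopology (charTopology N) := by
  classical
  intro U hU ⟨u, hu⟩
  let e : G →+ (N → UnitAddCircle) := AddMonoidHom.pi fun χ : N => χ.1
  have he : charTopology N = TopologicalSpace.induced e inferInstance :=
    (induced_to_pi _).symm
  rw [he] at hU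
  obtain ⟨O, hO, rfl⟩ := isOpen_induced_iff.1 hU
  have hW : (fun z => z + e u) ⁻¹' O ∈ 𝓝 (0 : N → UnitAddCircle) :=
    (hO.preimage (continuous_add_const (e u))).mem_nhds (by simpa using hu)
  obtain ⟨W, hW0, hW⟩ := exists_nhds_half_neg hW
  obtain ⟨t, -, ht⟩ := (isCompact_univ (X := N → UnitAddCircle)).elim_nhds_subcover
    (fun y => (fun z => z - y) ⁻¹' W) fun y _ =>
      (continuous_sub_right y).continuousAt.preimage_mem_nhds (by simpa using hW0)
  let r : (N → UnitAddCircle) → G := fun y => if h : ∃ f, e f - y ∈ W then h.choose else 0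
  refine ⟨(fun y => r y - u) '' t, t.finite_toSet.image _, Set.eq_univ_of_forall fun g => ?_⟩
  obtain ⟨y, hy, hgy⟩ := Set.mem_iUnion₂.1 (ht (Set.mem_univ (e g)))
  have hex : ∃ f, e f - y ∈ W := ⟨g, hgy⟩
  have hr : e (r y) - y ∈ W := by
    simp only [r, dif_pos hex]
    exact hex.choose_spec
  refine ⟨r y - u, ⟨y, hy, rfl⟩, g - r y + u, ?_, by simp⟩
  have := hW _ hgy _ hr
  rw [sub_sub_sub_cancel_right] at this
  simpa using this

/-- Every subgroup is an intersection of kernels of characters from `N`. -/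
def SeparatesSubgroups (N : Set (G →+ UnitAddCircle)) : Prop :=
  ∀ H : AddSubgroup G, ∀ g ∉ H, ∃ χ ∈ N, (∀ h ∈ H, χ h = 0) ∧ χ g ≠ 0

theorem SeparatesSubgroups.mono {N M : Set (G →+ UnitAddCircle)} (hN : SeparatesSubgroups N)
    (h : N ⊆ M) : SeparatesSubgroups M := fun H g hg =>
  let ⟨χ, hχ, h'⟩ := hN H g hg
  ⟨χ, h hχ, h'⟩

/-- Each subgroup is an intersection of closed kernels; applied to the zero subgroup, this gives the
Hausdorff property. -/
theorem SeparatesSubgroups.isSCGroupTopology {N : Set (G →+ UnitAddCircle)}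
    (hN : SeparatesSubgroups N) : IsSCGroupTopology (charTopology N) := by
  have hclosed : ∀ H : AddSubgroup G, IsClosed[charTopology N] (H : Set G) := by
    intro H
    have h : (H : Set G) = ⋂ χ : {χ ∈ N | ∀ h ∈ H, χ h = 0}, χ.1 ⁻¹' {0} := by
      ext g
      simp only [Set.mem_iInter, Subtype.forall]
      refine ⟨fun hg χ hχ => hχ.2 g hg, fun h => ?_⟩
      by_contra hg
      obtain ⟨χ, hχ, hH, hχg⟩ := hN H g hg
      exact hχg (h χ ⟨hχ, hH⟩)
    rw [h]
    let _ := charTopology N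
    exact isClosed_iInter fun χ => isClosed_singleton.preimage (continuous_charTopology χ.2.1)
  let _ := charTopology N
  have := isTopologicalAddGroup_charTopology N
  refine ⟨⟨inferInstance, ?_, isPrecompactTopology_charTopology N⟩, hclosed⟩
  exact IsTopologicalAddGroup.t2Space_iff_zero_closed.2 (by simpa using hclosed ⊥)

/-- A character continuous for `charTopology N` vanishes on the common kernel of finitely many
members of `N`. -/
theorem exists_finite_common_kernel_of_continuous {N : Set (G →+ UnitAddCircle)}
    {ψ : G →+ UnitAddCircle} (hψ : @Continuous _ _ (charTopology N) _ ψ) :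
    ∃ Φ ⊆ N, Φ.Finite ∧ ∀ x, (∀ χ ∈ Φ, χ x = 0) → ψ x = 0 := by
  let _ := charTopology N
  have hU : ψ ⁻¹' Metric.ball 0 (1 / 4) ∈ 𝓝 (0 : G) :=
    hψ.continuousAt.preimage_mem_nhds (by
      rw [map_zero]; exact Metric.ball_mem_nhds _ (by norm_num))
  rw [show 𝓝 (0 : G) = ⨅ χ : N, Filter.comap χ.1 (𝓝 0) by
    refine nhds_iInf.trans (iInf_congr fun χ => ?_)
    rw [nhds_induced, map_zero], Filter.mem_iInf] at hU
  obtain ⟨I, hI, S, hS, hUS⟩ := hU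
  refine ⟨Subtype.val '' I, by simp, hI.image _, fun x hx => ?_⟩
  -- The common kernel is a subgroup that `ψ` maps into the ball of radius `1 / 4`, which contains
  -- no nonzero subgroup.
  by_contra hne
  obtain ⟨n, hn⟩ := UnitAddCircle.exists_quarter_le_norm_nsmul hne
  have hmem : n • x ∈ ψ ⁻¹' Metric.ball 0 (1 / 4) := by
    rw [hUS, Set.mem_iInter]
    intro χ
    obtain ⟨T, hT, hTS⟩ := hS χ
    refine hTS ?_
    have h0 := hx χ.1.1 ⟨χ.1, χ.2, rfl⟩
    rw [Set.mem_preimage, map_nsmul, h0, smul_zero]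
    exact mem_of_mem_nhds hT
  rw [Set.mem_preimage, mem_ball_zero_iff, map_nsmul] at hmem
  exact absurd hn (not_le.2 hmem)

/-- A family of characters `ψ` is independent over `N` if no member vanishes on the common kernel
of finitely many other members and finitely many characters in `N`. -/
def IndependentOver (N : Set (G →+ UnitAddCircle)) {ι : Type*} (ψ : ι → G →+ UnitAddCircle) :
    Prop :=
  ∀ Φ ⊆ N, Φ.Finite → ∀ (Y : Set ι), Y.Finite → ∀ i ∉ Y,
    ∃ x, (∀ χ ∈ Φ, χ x = 0) ∧ (∀ j ∈ Y, ψ j x = 0) ∧ ψ i x ≠ 0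

/-- A set of indices can be read off its topology: if `i ∉ T`, continuity of `ψ i` for `N ∪ ψ '' T`
would make it vanish on a finite common kernel, against independence. -/
theorem IndependentOver.le_numSCGroupTopologies {N : Set (G →+ UnitAddCircle)}
    (hN : SeparatesSubgroups N) {ι : Type u} {ψ : ι → G →+ UnitAddCircle}
    (hψ : IndependentOver N ψ) : 2 ^ #ι ≤ numSCGroupTopologies G := by
  let Θ : Set ι → {τ : TopologicalSpace G // IsSCGroupTopology τ} := fun S =>
    ⟨charTopology (N ∪ ψ '' S), (hN.mono Set.subset_union_left).isSCGroupTopology⟩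
  have hle : ∀ S T : Set ι, charTopology (N ∪ ψ '' S) = charTopology (N ∪ ψ '' T) → S ⊆ T := by
    intro S T h i hi
    by_contra hiT
    have hc : @Continuous _ _ (charTopology (N ∪ ψ '' T)) _ (ψ i) :=
      h ▸ continuous_charTopology (Or.inr ⟨i, hi, rfl⟩)
    obtain ⟨Φ, hΦ, hfin, hker⟩ := exists_finite_common_kernel_of_continuous hc
    obtain ⟨Y, hYT, hY, hYΦ⟩ : ∃ Y ⊆ T, Y.Finite ∧ Φ ⊆ N ∪ ψ '' Y := by
      have h1 : Φ \ N ⊆ ψ '' T := fun χ hχ => (hΦ hχ.1).resolve_left hχ.2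
      exact Set.exists_subset_image_finite_and (p := fun t => Φ ⊆ N ∪ t).1
        ⟨Φ \ N, h1, hfin.subset Set.sdiff_subset, fun χ hχ => (em (χ ∈ N)).imp id fun h => ⟨hχ, h⟩⟩
    obtain ⟨x, hx, hxY, hne⟩ := hψ (Φ ∩ N) Set.inter_subset_right
      (hfin.subset Set.inter_subset_left) Y hY i fun hiY => hiT (hYT hiY)
    refine hne (hker x fun χ hχ => ?_)
    rcases hYΦ hχ with h | ⟨j, hj, rfl⟩
    · exact hx χ ⟨hχ, h⟩
    · exact hxY j hj
  have hΘ : Function.Injective Θ := fun S T h =>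
    (hle S T (congrArg Subtype.val h)).antisymm (hle T S (congrArg Subtype.val h).symm)
  simpa [numSCGroupTopologies, mk_set] using mk_le_of_injective hΘ

end CharacterTopology

/-! ### Torsion characters and separation of subgroups. -/

section Constructions

theorem exists_pos_nsmul_eq_zero_of_finite {M : Type*} [AddCommMonoid M] {S : Set M}
    (hS : S.Finite) (h : ∀ x ∈ S, IsOfFinAddOrder x) : ∃ m : ℕ, 0 < m ∧ ∀ x ∈ S, m • x = 0 := by
  classical
  lift S to Finset M using hS
  refine ⟨∏ x ∈ S, addOrderOf x, Finset.prod_pos fun x hx => (h x hx).addOrderOf_pos,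
    fun x hx => addOrderOf_dvd_iff_nsmul_eq_zero.1 (Finset.dvd_prod_of_mem _ hx)⟩

/-- The embedding of `ℚ / ℤ` into `ℝ / ℤ`. -/
noncomputable def ratAddCircleToUnitAddCircle : AddCircle (1 : ℚ) →+ UnitAddCircle :=
  QuotientAddGroup.map _ _ (Rat.castHom ℝ).toAddMonoidHom (by
    rw [AddSubgroup.zmultiples_le]
    exact AddSubgroup.mem_zmultiples_iff.2 ⟨1, by simp⟩)

theorem ratAddCircleToUnitAddCircle_injective :
    Function.Injective ratAddCircleToUnitAddCircle := by
  rw [injective_iff_map_eq_zero]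
  intro x hx
  obtain ⟨q, rfl⟩ := QuotientAddGroup.mk_surjective x
  obtain ⟨n, hn⟩ := (AddCircle.coe_eq_zero_iff (1 : ℝ)).1 hx
  refine (AddCircle.coe_eq_zero_iff (1 : ℚ)).2 ⟨n, ?_⟩
  rw [zsmul_one] at hn ⊢
  have : ((n : ℚ) : ℝ) = (q : ℝ) := by simpa using hn
  exact_mod_cast this

theorem isOfFinAddOrder_ratAddCircle (x : AddCircle (1 : ℚ)) : IsOfFinAddOrder x := by
  obtain ⟨q, rfl⟩ := QuotientAddGroup.mk_surjective x
  refine isOfFinAddOrder_iff_nsmul_eq_zero.2 ⟨q.den, q.den_pos, ?_⟩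
  change q.den • (q : AddCircle (1 : ℚ)) = 0
  rw [← AddCircle.coe_nsmul, AddCircle.coe_eq_zero_iff]
  exact ⟨q.num, by rw [zsmul_one, nsmul_eq_mul, mul_comm, Rat.mul_den_eq_num]⟩

variable {G : Type u} [AddCommGroup G]

/-- The characters with values in the torsion subgroup separate subgroups. -/
theorem separatesSubgroups_isOfFinAddOrder_apply :
    SeparatesSubgroups {χ : G →+ UnitAddCircle | ∀ x, IsOfFinAddOrder (χ x)} := by
  intro H g hg
  have hne : (g : G ⧸ H) ≠ 0 := fun h => hg ((QuotientAddGroup.eq_zero_iff g).1 h)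
  obtain ⟨c, hc⟩ := CharacterModule.exists_character_apply_ne_zero_of_ne_zero hne
  let c' : G ⧸ H →+ AddCircle (1 : ℚ) := c
  refine ⟨(ratAddCircleToUnitAddCircle.comp c').comp (QuotientAddGroup.mk' H), fun x => ?_,
    fun h hh => ?_, fun h => ?_⟩
  · exact ratAddCircleToUnitAddCircle.isOfFinAddOrder (isOfFinAddOrder_ratAddCircle (c' x))
  · have : (h : G ⧸ H) = 0 := (QuotientAddGroup.eq_zero_iff h).2 hh
    simp [this]
  · exact hc (ratAddCircleToUnitAddCircle_injective (h.trans (map_zero _).symm))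

/-- The `p`-component of the torsion element `g` has order dividing `p`. -/
def IsElementaryAt (p : ℕ) (g : G) : Prop := ∃ n : ℕ, n.Coprime p ∧ (n * p) • g = 0

theorem IsElementaryAt.zero (p : ℕ) : IsElementaryAt p (0 : G) :=
  ⟨1, Nat.coprime_one_left p, smul_zero _⟩

theorem IsElementaryAt.add {p : ℕ} {g h : G} (hg : IsElementaryAt p g) (hh : IsElementaryAt p h) :
    IsElementaryAt p (g + h) := by
  obtain ⟨n, hn, hg⟩ := hg
  obtain ⟨m, hm, hh⟩ := hh
  refine ⟨n * m, Nat.Coprime.mul_left hn hm, ?_⟩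
  have h1 : (n * m * p) • g = m • ((n * p) • g) := by rw [← mul_nsmul']; ring_nf
  have h2 : (n * m * p) • h = n • ((m * p) • h) := by rw [← mul_nsmul']; ring_nf
  rw [smul_add, h1, h2, hg, hh, smul_zero, smul_zero, add_zero]

theorem IsElementaryAt.map {p : ℕ} {g : G} {M : Type*} [AddCommGroup M]
    (hg : IsElementaryAt p g) (f : G →+ M) : IsElementaryAt p (f g) := by
  obtain ⟨n, hn, hg⟩ := hg
  exact ⟨n, hn, by rw [← map_nsmul, hg, map_zero]⟩

/-- Every primary component of the torsion group `G` is elementary. -/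
def HasElementaryPrimaryComponents (G : Type*) [AddCommGroup G] : Prop :=
  ∀ p : ℕ, p.Prime → ∀ g : G, IsElementaryAt p g

theorem HasElementaryPrimaryComponents.isAddTorsion (hG : HasElementaryPrimaryComponents G) :
    IsAddTorsion G := by
  intro g
  obtain ⟨n, hn, h⟩ := hG 2 Nat.prime_two g
  refine isOfFinAddOrder_iff_nsmul_eq_zero.2 ⟨n * 2, Nat.pos_of_ne_zero ?_, h⟩
  rintro h0
  obtain rfl : n = 0 := by omega
  simp at hn

/-- If every primary component of `G` is elementary, then the torsion characters separate
subgroups. -/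
theorem HasElementaryPrimaryComponents.separatesSubgroups
    (hG : HasElementaryPrimaryComponents G) :
    SeparatesSubgroups {χ : G →+ UnitAddCircle | IsOfFinAddOrder χ} := by
  intro H g hg
  have hne : (g : G ⧸ H) ≠ 0 := fun h => hg ((QuotientAddGroup.eq_zero_iff g).1 h)
  obtain ⟨p, hp, hpdvd⟩ := Nat.exists_prime_and_dvd (mt AddMonoid.addOrderOf_eq_one_iff.1 hne)
  -- A character killing `p G` is killed by `p`, so has finite order. As the `p`-components are
  -- elementary and `p` divides the order of `g` modulo `H`, the element `g` stays outside `H + p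
  -- G`.
  let D : AddSubgroup G := (nsmulAddMonoidHom p : G →+ G).range
  have hgD : g ∉ H ⊔ D := by
    intro hmem
    obtain ⟨h, hh, _, ⟨z, rfl⟩, hsum⟩ := AddSubgroup.mem_sup.1 hmem
    obtain ⟨n, hn, hz⟩ := hG p hp z
    have hng : n • g = n • h := by
      rw [← hsum, smul_add, nsmulAddMonoidHom_apply, ← mul_nsmul', hz, add_zero]
    have h0 : n • (g : G ⧸ H) = 0 := by
      rw [← QuotientAddGroup.mk_nsmul, QuotientAddGroup.eq_zero_iff, hng]
      exact H.nsmul_mem hh n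
    have hpn := hpdvd.trans (addOrderOf_dvd_of_nsmul_eq_zero h0)
    exact hp.one_lt.ne' (Nat.dvd_one.1 (hn ▸ Nat.dvd_gcd hpn dvd_rfl))
  obtain ⟨χ, -, hχ, hχg⟩ := separatesSubgroups_isOfFinAddOrder_apply (H ⊔ D) g hgD
  refine ⟨χ, isOfFinAddOrder_iff_nsmul_eq_zero.2 ⟨p, hp.pos, ?_⟩,
    fun h hh => hχ h (AddSubgroup.mem_sup_left hh), hχg⟩
  ext x
  rw [AddMonoidHom.nsmul_apply, ← map_nsmul, AddMonoidHom.zero_apply]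
  exact hχ _ (AddSubgroup.mem_sup_right ⟨x, rfl⟩)

/-! ### Independent families of sets and of characters. -/

/-- The pattern `b = (F, E)` describes the trace of `X` on the finite set `F`. -/
def MatchesPattern {κ : Type*} (X : Set κ) (b : Finset κ × Finset κ) : Prop :=
  ∀ k ∈ b.1, k ∈ X ↔ k ∈ b.2

/-- The Fichtenholz–Kantorovich independent family: record the trace of `X` on finitely many points,
one distinguishing `X` from each member of `Y`. -/
theorem exists_pattern_matches_only {κ : Type*} {Y : Set (Set κ)} (hY : Y.Finite) {X : Set κ}
    (hX : X ∉ Y) : ∃ b, MatchesPattern X b ∧ ∀ Z ∈ Y, ¬ MatchesPattern Z b := by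
  classical
  lift Y to Finset (Set κ) using hY
  have hd : ∀ Z : Y, ∃ k, ¬ (k ∈ X ↔ k ∈ Z.1) := by
    intro Z
    by_contra! h
    exact hX ((Set.ext h : X = Z) ▸ Z.2)
  choose d hd using hd
  refine ⟨(Finset.univ.image d, (Finset.univ.image d).filter (· ∈ X)), fun k hk => ?_,
    fun Z hZ h => ?_⟩
  · exact ⟨fun hX => Finset.mem_filter.2 ⟨hk, hX⟩, fun h => (Finset.mem_filter.1 h).2⟩
  · have hdZ := Finset.mem_image_of_mem d (Finset.mem_univ ⟨Z, hZ⟩)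
    refine hd ⟨Z, hZ⟩ ?_
    rw [h _ hdZ, Finset.mem_filter]
    exact ⟨fun h => ⟨hdZ, h⟩, And.right⟩

open Classical in
/-- The character of `V × ⨁ P` that is `j` on the summands with index matching `X` and zero on
all others. -/
noncomputable def patternChar (V : Type*) {κ P : Type*} [AddCommGroup V] [AddCommGroup P]
    (j : P →+ UnitAddCircle) (X : Set κ) :
    V × ((Finset κ × Finset κ) →₀ P) →+ UnitAddCircle :=
  (Finsupp.liftAddHom fun b => if MatchesPattern X b then j else 0).comp (AddMonoidHom.snd _ _)

open Classical in
theorem patternChar_single {V κ P : Type*} [AddCommGroup V] [AddCommGroup P]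
    (j : P →+ UnitAddCircle) (X : Set κ) (b : Finset κ × Finset κ) (v : V) (p : P) :
    patternChar V j X (v, Finsupp.single b p) = if MatchesPattern X b then j p else 0 := by
  simp only [patternChar, AddMonoidHom.comp_apply, AddMonoidHom.coe_snd,
    Finsupp.liftAddHom_apply_single]
  split_ifs <;> rfl

/-- On a summand whose pattern matches `X` but no member of `Y`, only the character of `X` is
nonzero. Independence thus reduces to a question about `j` and `N` on one copy of `P`. -/
theorem independentOver_patternChar {V κ : Type u} {P : Type} [AddCommGroup V] [AddCommGroup P]
    {j : P →+ UnitAddCircle} {N : Set (V × ((Finset κ × Finset κ) →₀ P) →+ UnitAddCircle)}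
    (h : ∀ Φ ⊆ N, Φ.Finite → ∀ b, ∃ p, (∀ χ ∈ Φ, χ (0, Finsupp.single b p) = 0) ∧ j p ≠ 0) :
    IndependentOver N (patternChar V j) := by
  intro Φ hΦ hfin Y hY X hX
  obtain ⟨b, hb, hbY⟩ := exists_pattern_matches_only hY hX
  obtain ⟨p, hp, hj⟩ := h Φ hΦ hfin b
  refine ⟨(0, Finsupp.single b p), hp, fun Z hZ => ?_, ?_⟩
  · rw [patternChar_single, if_neg (hbY Z hZ)]
  · rwa [patternChar_single, if_pos hb]

/-! ### The sum of all `ZMod p`, for the torsion group. -/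

instance neZero_primes (p : Nat.Primes) : NeZero (p : ℕ) := ⟨p.2.ne_zero⟩

/-- The sum of one copy of `ZMod p` for every prime `p`. -/
abbrev PrimeSum : Type := Π₀ p : Nat.Primes, ZMod p

theorem exists_primes_gt (m : ℕ) : ∃ p : Nat.Primes, m < p :=
  let ⟨p, hmp, hp⟩ := Nat.exists_infinite_primes (m + 1)
  ⟨⟨p, hp⟩, hmp⟩

theorem nsmul_primeSum_single_one (n : ℕ) (p : Nat.Primes) :
    n • (DFinsupp.single p 1 : PrimeSum) = DFinsupp.single p (n : ZMod p) := by
  rw [← nsmul_one]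
  exact (map_nsmul (DFinsupp.singleAddHom (fun p : Nat.Primes => ZMod p) p) n 1).symm

/-- The homomorphism sending the generator of `ZMod p` to `1 / p`. -/
noncomputable def primeSumChar : PrimeSum →+ UnitAddCircle :=
  DFinsupp.liftAddHom fun p => ZMod.toAddCircle (N := p)

theorem primeSumChar_single_one_ne_zero (p : Nat.Primes) :
    primeSumChar (DFinsupp.single p 1) ≠ 0 := by
  have : Fact (p : ℕ).Prime := ⟨p.2⟩
  rw [primeSumChar, DFinsupp.liftAddHom_apply_single, Ne, ZMod.toAddCircle_eq_zero]
  exact one_ne_zero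

theorem HasElementaryPrimaryComponents.prod {A B : Type*} [AddCommGroup A] [AddCommGroup B]
    (hA : HasElementaryPrimaryComponents A) (hB : HasElementaryPrimaryComponents B) :
    HasElementaryPrimaryComponents (A × B) := by
  rintro p hp ⟨a, b⟩
  have := (hA p hp a).map (AddMonoidHom.inl A B)
  simpa using this.add ((hB p hp b).map (AddMonoidHom.inr A B))

theorem HasElementaryPrimaryComponents.finsupp (B : Type*) {P : Type*} [AddCommGroup P]
    (hP : HasElementaryPrimaryComponents P) : HasElementaryPrimaryComponents (B →₀ P) := by
  intro p hp g
  induction g using Finsupp.induction_linear with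
  | zero => exact .zero p
  | add f g hf hg => exact hf.add hg
  | single b x => exact (hP p hp x).map (Finsupp.singleAddHom b)

theorem hasElementaryPrimaryComponents_zmod {q : ℕ} (hq : q.Prime) :
    HasElementaryPrimaryComponents (ZMod q) := by
  intro p hp g
  rcases eq_or_ne q p with rfl | hne
  · exact ⟨1, Nat.coprime_one_left q, by simp⟩
  · exact ⟨q, (Nat.coprime_primes hq hp).2 hne, by simp⟩

theorem hasElementaryPrimaryComponents_primeSum : HasElementaryPrimaryComponents PrimeSum := by
  classical
  intro p hp g
  induction g using DFinsupp.induction with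
  | h0 => exact .zero p
  | ha q x f _ _ hf =>
    exact ((hasElementaryPrimaryComponents_zmod q.2 p hp x).map
      (DFinsupp.singleAddHom (fun p : Nat.Primes => ZMod p) q)).add hf

/-- The pattern characters of the sum of all `ZMod p` are independent over the torsion characters. -/
theorem independentOver_primeSumChar (V κ : Type u) [AddCommGroup V] :
    IndependentOver {χ : V × ((Finset κ × Finset κ) →₀ PrimeSum) →+ UnitAddCircle |
      IsOfFinAddOrder χ} (patternChar V (κ := κ) primeSumChar) := by
  refine independentOver_patternChar fun Φ hΦ hfin b => ?_
  obtain ⟨m, hm, hmΦ⟩ := exists_pos_nsmul_eq_zero_of_finite hfin hΦ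
  -- A prime above `m` is coprime to `m`, so a character killed by `m` vanishes on elements of order
  -- `p`.
  obtain ⟨p, hpm⟩ := exists_primes_gt m
  refine ⟨DFinsupp.single p 1, fun χ hχ => ?_, primeSumChar_single_one_ne_zero _⟩
  set x : V × ((Finset κ × Finset κ) →₀ PrimeSum) :=
    (0, Finsupp.single b (DFinsupp.single p 1)) with hx
  have hpx : (p : ℕ) • x = 0 := by
    rw [hx, Prod.smul_mk, smul_zero, Finsupp.smul_single, nsmul_primeSum_single_one,
      show ((p : ℕ) : ZMod p) = 0 from ZMod.natCast_self p, DFinsupp.single_zero,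
      Finsupp.single_zero, Prod.mk_zero_zero]
  have h1 : addOrderOf (χ x) ∣ p := addOrderOf_dvd_of_nsmul_eq_zero (by
    rw [← map_nsmul, hpx, map_zero])
  have h2 : addOrderOf (χ x) ∣ m := addOrderOf_dvd_of_nsmul_eq_zero (by
    rw [← AddMonoidHom.nsmul_apply, hmΦ χ hχ, AddMonoidHom.zero_apply])
  have hcop : Nat.Coprime (p : ℕ) m :=
    (Nat.Prime.coprime_iff_not_dvd p.2).2 fun h => by
      have := Nat.le_of_dvd hm h
      omega
  exact AddMonoid.addOrderOf_eq_one_iff.1 (Nat.dvd_one.1 (hcop ▸ Nat.dvd_gcd h1 h2))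

/-! ### Characters of free groups, for the group of rank `β`. -/

/-- The class of `√2`, an element of infinite order in the circle group. -/
noncomputable def sqrtTwoCircle : UnitAddCircle := ((√2 : ℝ) : UnitAddCircle)

theorem nsmul_sqrtTwoCircle_ne_zero {m : ℕ} (hm : 0 < m) : m • sqrtTwoCircle ≠ 0 := by
  intro h
  rw [sqrtTwoCircle, ← AddCircle.coe_nsmul, AddCircle.coe_eq_zero_iff] at h
  obtain ⟨n, hn⟩ := h
  rw [zsmul_one, nsmul_eq_mul] at hn
  refine irrational_sqrt_two ⟨n / m, ?_⟩
  have : (m : ℝ) ≠ 0 := by positivity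
  push_cast
  rw [hn]
  field_simp

/-- Some `m > 0` kills the torsion values of finitely many characters at a generator. They all
vanish on `m` times that generator, while `m` does not kill the class of `√2`. -/
theorem independentOver_sqrtTwoCircle (V κ : Type u) [AddCommGroup V] :
    IndependentOver {χ : V × ((Finset κ × Finset κ) →₀ ℤ) →+ UnitAddCircle |
      ∀ x, IsOfFinAddOrder (χ x)} (patternChar V (κ := κ) (zmultiplesHom _ sqrtTwoCircle)) := by
  refine independentOver_patternChar fun Φ hΦ hfin b => ?_
  obtain ⟨m, hm, hmΦ⟩ := exists_pos_nsmul_eq_zero_of_finite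
    (hfin.image fun χ => χ (0, Finsupp.single b 1)) (by
      rintro _ ⟨χ, hχ, rfl⟩
      exact hΦ hχ _)
  refine ⟨m, fun χ hχ => ?_, by simpa using nsmul_sqrtTwoCircle_ne_zero hm⟩
  have h := hmΦ _ ⟨χ, hχ, rfl⟩
  rw [← map_nsmul, Prod.smul_mk, smul_zero, Finsupp.smul_single] at h
  simpa using h

/-! ### Ranks, cardinalities and the two families of groups. -/

theorem torsionFreeRank_prod_of_exponent_two {V K : Type u} [AddCommGroup V] [AddCommGroup K]
    (hV : ∀ v : V, v + v = 0) : torsionFreeRank (V × K) = torsionFreeRank K := by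
  have hker : Module.rank ℤ (LinearMap.ker (LinearMap.snd ℤ V K)) = 0 := by
    rw [rank_eq_zero_iff]
    rintro ⟨⟨v, k⟩, hk⟩
    obtain rfl : k = 0 := hk
    refine ⟨2, two_ne_zero, Subtype.ext ?_⟩
    simp [two_smul, hV]
  rw [torsionFreeRank, ← rank_quotient_add_rank_of_isDomain (LinearMap.ker (LinearMap.snd ℤ V K)),
    hker, add_zero]
  exact (LinearMap.quotKerEquivOfSurjective _ LinearMap.snd_surjective).rank_eq

theorem add_self_eq_zero_finsupp_zmod_two {A : Type*} (v : A →₀ ZMod 2) : v + v = 0 := by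
  ext a
  exact CharTwo.add_self_eq_zero (v a)

theorem mk_prod_eq {α β : Cardinal.{u}} {V K : Type u} (hα : ℵ₀ ≤ α) (hβ : β ≤ α)
    (hβ0 : β ≠ 0) (hV : #V = α) (hK : #K = β) : #(V × K) = α := by
  rw [mk_prod, lift_id, lift_id, hV, hK, mul_eq_left hα hβ hβ0]

theorem mk_finset_prod_finset {κ : Type u} [Infinite κ] : #(Finset κ × Finset κ) = #κ := by
  rw [mk_prod, lift_id, mk_finset_of_infinite, mul_eq_self (aleph0_le_mk κ)]

theorem mk_finsupp_countable (B : Type u) (P : Type) [Infinite B] [AddCommGroup P] [Nontrivial P]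
    [Countable P] : #(B →₀ P) = #B := by
  rw [mk_finsupp_lift_of_infinite, lift_uzero, max_eq_left]
  exact (lift_le_aleph0.2 (mk_le_aleph0 (α := P))).trans (aleph0_le_mk B)

/-- Both sides are compared with `2 ^ α`; strictness is Cantor's theorem for `2 ^ α`. -/
theorem two_power_two_power_lt {α β : Cardinal.{u}} (h : 2 ^ β ≤ α) :
    (2 : Cardinal.{u}) ^ ((2 : Cardinal.{u}) ^ β) < 2 ^ ((2 : Cardinal.{u}) ^ α) :=
  (power_le_power_left two_ne_zero h).trans_lt (cantor _)

instance nontrivial_primeSum : Nontrivial PrimeSum :=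
  ⟨DFinsupp.single ⟨2, Nat.prime_two⟩ 1, 0, fun h =>
    primeSumChar_single_one_ne_zero ⟨2, Nat.prime_two⟩ (by rw [h, map_zero])⟩

/-- A torsion group of size `α`, not of bounded order, with exactly `2 ^ 2 ^ β` SC-group
topologies. -/
theorem exists_isAddTorsion_numSCGroupTopologies {α β : Cardinal.{u}} (hα : ℵ₀ ≤ α)
    (hβ : ℵ₀ ≤ β) (h : 2 ^ β ≤ α) :
    ∃ (G : Type u) (_ : AddCommGroup G), #G = α ∧
      numSCGroupTopologies G = 2 ^ ((2 : Cardinal.{u}) ^ β) ∧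
      IsAddTorsion G ∧ ¬ IsOfBoundedOrder G := by
  induction α using Cardinal.inductionOn with | _ A
  induction β using Cardinal.inductionOn with | _ κ
  have : Infinite A := infinite_iff.2 hα
  have : Infinite κ := infinite_iff.2 hβ
  have hle : #κ ≤ #A := (cantor _).le.trans h
  have hV : #(A →₀ ZMod 2) = #A := mk_finsupp_countable A (ZMod 2)
  have hK : #((Finset κ × Finset κ) →₀ PrimeSum) = #κ := by
    rw [mk_finsupp_countable, mk_finset_prod_finset]
  have hel : HasElementaryPrimaryComponents
      ((A →₀ ZMod 2) × ((Finset κ × Finset κ) →₀ PrimeSum)) :=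
    ((hasElementaryPrimaryComponents_zmod Nat.prime_two).finsupp A).prod
      (hasElementaryPrimaryComponents_primeSum.finsupp _)
  refine ⟨(A →₀ ZMod 2) × ((Finset κ × Finset κ) →₀ PrimeSum), inferInstance,
    mk_prod_eq hα hle (aleph0_pos.trans_le hβ).ne' hV hK, le_antisymm ?_ ?_,
    hel.isAddTorsion, ?_⟩
  · rw [← hK]
    exact numSCGroupTopologies_le_of_exponent_two add_self_eq_zero_finsupp_zmod_two
  · rw [← mk_set]
    exact (independentOver_primeSumChar _ κ).le_numSCGroupTopologies hel.separatesSubgroups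
  · rintro ⟨n, hn, hG⟩
    -- No positive `n` kills `ZMod p` once `p > n`.
    obtain ⟨p, hpn⟩ := exists_primes_gt n
    have h := congrArg Prod.snd (hG (0, Finsupp.single default (DFinsupp.single p 1)))
    rw [Prod.smul_snd, Finsupp.smul_single, nsmul_primeSum_single_one, Prod.snd_zero,
      Finsupp.single_eq_zero] at h
    have h3 : ((n : ℕ) : ZMod p) = 0 :=
      DFinsupp.single_injective (β := fun p : Nat.Primes => ZMod p)
        (h.trans (DFinsupp.single_zero p).symm)
    have := Nat.le_of_dvd hn ((ZMod.natCast_eq_zero_iff n p).1 h3)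
    omega

/-- A group of size `α` and torsion-free rank `β`, not of bounded order, with exactly `2 ^ 2 ^ β`
SC-group topologies. -/
theorem exists_torsionFreeRank_numSCGroupTopologies {α β : Cardinal.{u}} (hα : ℵ₀ ≤ α)
    (hβ : ℵ₀ ≤ β) (h : 2 ^ β ≤ α) :
    ∃ (G : Type u) (_ : AddCommGroup G), #G = α ∧
      numSCGroupTopologies G = 2 ^ ((2 : Cardinal.{u}) ^ β) ∧
      torsionFreeRank G = β ∧ ¬ IsOfBoundedOrder G := by
  induction α using Cardinal.inductionOn with | _ A
  induction β using Cardinal.inductionOn with | _ κ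
  have : Infinite A := infinite_iff.2 hα
  have : Infinite κ := infinite_iff.2 hβ
  have hle : #κ ≤ #A := (cantor _).le.trans h
  have hV : #(A →₀ ZMod 2) = #A := mk_finsupp_countable A (ZMod 2)
  have hK : #((Finset κ × Finset κ) →₀ ℤ) = #κ := by
    rw [mk_finsupp_countable, mk_finset_prod_finset]
  refine ⟨(A →₀ ZMod 2) × ((Finset κ × Finset κ) →₀ ℤ), inferInstance,
    mk_prod_eq hα hle (aleph0_pos.trans_le hβ).ne' hV hK, le_antisymm ?_ ?_, ?_, ?_⟩
  · rw [← hK]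
    exact numSCGroupTopologies_le_of_exponent_two add_self_eq_zero_finsupp_zmod_two
  · rw [← mk_set]
    exact (independentOver_sqrtTwoCircle _ κ).le_numSCGroupTopologies
      separatesSubgroups_isOfFinAddOrder_apply
  · rw [torsionFreeRank_prod_of_exponent_two add_self_eq_zero_finsupp_zmod_two, torsionFreeRank,
      ← mk_finset_prod_finset]
    simp
  · rintro ⟨n, hn, hG⟩
    have h := hG (0, Finsupp.single default 1)
    have h2 := DFunLike.congr_fun (congrArg Prod.snd h) default
    have h3 : n = 0 := by simpa using h2
    omega

end Constructions

theorem mainTheorem9 :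
    (∀ α β : Cardinal.{u}, ℵ₀ ≤ α → ℵ₀ ≤ β → 2 ^ β ≤ α →
      (∃ (G : Type u) (_ : AddCommGroup G), #G = α ∧
        numSCGroupTopologies G = 2 ^ ((2 : Cardinal.{u}) ^ β) ∧
        (2 : Cardinal.{u}) ^ ((2 : Cardinal.{u}) ^ β) < 2 ^ ((2 : Cardinal.{u}) ^ #G) ∧
        IsAddTorsion G) ∧
      (∃ (G : Type u) (_ : AddCommGroup G), #G = α ∧
        numSCGroupTopologies G = 2 ^ ((2 : Cardinal.{u}) ^ β) ∧
        (2 : Cardinal.{u}) ^ ((2 : Cardinal.{u}) ^ β) < 2 ^ ((2 : Cardinal.{u}) ^ #G) ∧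
        torsionFreeRank G = β ∧ β < α)) ∧
    (¬ ∀ (G : Type u) [AddCommGroup G], Infinite G → ¬ IsOfBoundedOrder G →
        IsAddTorsion G →
        numSCGroupTopologies G = 2 ^ ((2 : Cardinal.{u}) ^ #G)) ∧
    (¬ ∀ (G : Type u) [AddCommGroup G], Infinite G → ¬ IsOfBoundedOrder G →
        0 < torsionFreeRank G → torsionFreeRank G < #G →
        numSCGroupTopologies G = 2 ^ ((2 : Cardinal.{u}) ^ #G)) := by
  have key : ∀ α β : Cardinal.{u}, 2 ^ β ≤ α → ∀ (G : Type u) [AddCommGroup G], #G = α →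
      (2 : Cardinal.{u}) ^ ((2 : Cardinal.{u}) ^ β) < 2 ^ ((2 : Cardinal.{u}) ^ #G) := by
    intro α β h G _ hG
    rw [hG]
    exact two_power_two_power_lt h
  -- Both counterexamples take `β = ℵ₀` and `α = 2 ^ ℵ₀`.
  have hcont : ℵ₀ ≤ (2 : Cardinal.{u}) ^ (ℵ₀ : Cardinal.{u}) := (cantor _).le
  refine ⟨fun α β hα hβ h => ⟨?_, ?_⟩, fun hall => ?_, fun hall => ?_⟩
  · obtain ⟨G, _, hG, hnum, htor, -⟩ := exists_isAddTorsion_numSCGroupTopologies hα hβ h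
    exact ⟨G, _, hG, hnum, key α β h G hG, htor⟩
  · obtain ⟨G, _, hG, hnum, hrank, -⟩ := exists_torsionFreeRank_numSCGroupTopologies hα hβ h
    exact ⟨G, _, hG, hnum, key α β h G hG, hrank, (cantor _).trans_le h⟩
  · obtain ⟨G, _, hG, hnum, htor, hbdd⟩ :=
      exists_isAddTorsion_numSCGroupTopologies hcont le_rfl le_rfl
    have hinf : Infinite G := infinite_iff.2 (hG ▸ hcont)
    exact (key _ _ le_rfl G hG).ne (hnum.symm.trans (hall G hinf hbdd htor))
  · obtain ⟨G, _, hG, hnum, hrank, hbdd⟩ :=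
      exists_torsionFreeRank_numSCGroupTopologies hcont le_rfl le_rfl
    have hinf : Infinite G := infinite_iff.2 (hG ▸ hcont)
    refine (key _ _ le_rfl G hG).ne (hnum.symm.trans (hall G hinf hbdd ?_ ?_))
    · rw [hrank]; exact aleph0_pos
    · rw [hrank, hG]; exact cantor _
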